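/- For a topological space $X$ let $F(X,2)=\{(x_1,x_2)\in X\times X : x_1\neq x_2\}$ be the ordered configuration space of two distinct points of $X$, with the subspace topology from $X\times X$. Let $n\geq 1$ and let $G$ be a compact connected (real, smooth) Lie group of dimension $m\geq 1$. Then $F(G\times\mathbb{R}^n,2)$ is homotopy equivalent to $$G\times\bigl(G\vee \mathbb{S}^{m+n-1}\bigr),$$ where $\mathbb{S}^{m+n-1}$ is the unit sphere in $\mathbb{R}^{m+n}$ and the wedge sum $G\vee\mathbb{S}^{m+n-1}$ (the quotient of the disjoint union identifying a base point of $G$ with a base point of the sphere) is formed with respect to any choice of base points. -/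

import Mathlib

open scoped Manifold ContDiff ContinuousMap

/-- The ordered configuration space `F(X, k)`: the `k`-tuples of pairwise distinct points of `X`,
with the subspace topology inherited from the product `X ^ k`. -/
abbrev ConfigurationSpace (X : Type*) (k : ℕ) : Type _ :=
  {x : Fin k → X // Function.Injective x}

/-- The relation on the disjoint union `X ⊕ Y` which identifies the base point `x₀` of `X` with
the base point `y₀` of `Y`. -/
inductive WedgeRel {X Y : Type*} (x₀ : X) (y₀ : Y) : X ⊕ Y → X ⊕ Y → Prop
  | glue : WedgeRel x₀ y₀ (Sum.inl x₀) (Sum.inr y₀)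

/-- The wedge sum `(X, x₀) ∨ (Y, y₀)`: the quotient of the disjoint union `X ⊕ Y` by the
equivalence relation generated by `x₀ ∼ y₀`, with the quotient topology. -/
abbrev Wedge {X Y : Type*} (x₀ : X) (y₀ : Y) : Type _ :=
  Quot (WedgeRel x₀ y₀)

open Set Filter Topology

/-! Write B for ℝⁿ. Translating the second point by the first splits the configuration space as (G ×
B) × (G × B minus (1, 0)), and G × B contracts onto G. It remains to identify the punctured product
with the wedge, seen as the axes of G × S.

Take a chart at 1 and a nonzero v in B. `inclusion` places G as G × {v} and the sphere around the
puncture. `retraction` shrinks the chart radially by `lam` in the G coordinate and normalizes ν·(a,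
b) + μ·(0, v) in the sphere coordinate. The supports of ν and `lam` are disjoint, so the image lies
on the axes. `combination_ne_zero` is the crux: μ vanishes only on the ray from the puncture along
-v, where ν is positive, so the segments from the identity never meet the puncture. The
straight-line homotopies for both composites rest on it. -/

/-! ### The wedge as a union of axes -/

/-- The union of the two axes through `(x₀, y₀)` in the product `X × Y`. -/
abbrev WedgeAxes {X Y : Type*} (x₀ : X) (y₀ : Y) : Type _ :=
  {p : X × Y // p.1 = x₀ ∨ p.2 = y₀}

/-- The wedge of two compact Hausdorff spaces is homeomorphic to the union of the axes. -/
theorem Wedge.nonempty_homeomorph_wedgeAxes {X Y : Type*} [TopologicalSpace X]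
    [TopologicalSpace Y] [CompactSpace X] [CompactSpace Y] [T2Space X] [T2Space Y]
    (x₀ : X) (y₀ : Y) : Nonempty (Wedge x₀ y₀ ≃ₜ WedgeAxes x₀ y₀) := by
  let F : X ⊕ Y → WedgeAxes x₀ y₀ :=
    Sum.elim (fun x => ⟨(x, y₀), Or.inr rfl⟩) (fun y => ⟨(x₀, y), Or.inl rfl⟩)
  have hF : Continuous F := by
    refine continuous_sumElim.2 ⟨?_, ?_⟩ <;> exact Continuous.subtype_mk (by fun_prop) _
  have hr : ∀ a b, WedgeRel x₀ y₀ a b → F a = F b := by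
    rintro _ _ ⟨⟩; rfl
  have hglue : Quot.mk (WedgeRel x₀ y₀) (Sum.inl x₀) = Quot.mk _ (Sum.inr y₀) :=
    Quot.sound WedgeRel.glue
  have hbij : Function.Bijective (Quot.lift F hr) := by
    constructor
    · rintro ⟨a | a⟩ ⟨b | b⟩ h
      · have h1 : a = b := congrArg (fun p => p.1.1) h
        rw [h1]
      · have h1 : a = x₀ := congrArg (fun p => p.1.1) h
        have h2 : y₀ = b := congrArg (fun p => p.1.2) h
        subst h1 h2; exact hglue
      · have h1 : x₀ = b := congrArg (fun p => p.1.1) h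
        have h2 : a = y₀ := congrArg (fun p => p.1.2) h
        subst h1 h2; exact hglue.symm
      · have h1 : a = b := congrArg (fun p => p.1.2) h
        rw [h1]
    · rintro ⟨⟨x, y⟩, h | h⟩
      · obtain rfl : x = x₀ := h
        exact ⟨Quot.mk _ (Sum.inr y), rfl⟩
      · obtain rfl : y = y₀ := h
        exact ⟨Quot.mk _ (Sum.inl x), rfl⟩
  have hc : Continuous (Equiv.ofBijective _ hbij) := continuous_quot_lift hr hF
  exact ⟨hc.homeoOfEquivCompactToT2⟩

/-- A homeomorphism of the first factor moves the base point of the union of the axes. -/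
def WedgeAxes.homeomorphOfEq {X Y : Type*} [TopologicalSpace X] [TopologicalSpace Y]
    {x₀ x₁ : X} (y₀ : Y) (e : X ≃ₜ X) (he : e x₀ = x₁) :
    WedgeAxes x₀ y₀ ≃ₜ WedgeAxes x₁ y₀ :=
  (e.prodCongr (Homeomorph.refl Y)).subtype (by
    rintro ⟨x, y⟩
    simp [← he])

/-! ### Radial functions in a chart -/

namespace PuncturedProduct

variable {G A : Type*} [TopologicalSpace G]
  [NormedAddCommGroup A] [NormedSpace ℝ A]

section Chart

/-- The distance to the centre in the chart parametrized by `j`, truncated at `1`. -/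
noncomputable def radius (j : A → G) : G → ℝ :=
  Function.extend j (fun a => min ‖a‖ 1) (fun _ => 1)

/-- The coordinate vector in the chart parametrized by `j`, cut off outside the unit ball. -/
noncomputable def cutVector (j : A → G) : G → A :=
  Function.extend j (fun a => max 0 (min 1 (2 - 2 * ‖a‖)) • a) (fun _ => 0)

/-- Multiplication by the scalar `k` in the chart parametrized by `j`. -/
noncomputable def scale (j : A → G) (k : ℝ) : G → G :=
  Function.extend j (fun a => j (k • a)) id

variable {j : A → G}

theorem radius_apply (hj : IsOpenEmbedding j) (a : A) :
    radius j (j a) = min ‖a‖ 1 := hj.injective.extend_apply _ _ _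

theorem cutVector_apply (hj : IsOpenEmbedding j) (a : A) : cutVector j (j a) =
    max 0 (min 1 (2 - 2 * ‖a‖)) • a :=
  hj.injective.extend_apply _ _ _

theorem scale_apply (hj : IsOpenEmbedding j) (k : ℝ) (a : A) : scale j k (j a) = j (k • a) :=
  hj.injective.extend_apply _ _ _

/-- The closed unit ball is compact, so its image is closed in the Hausdorff space G; off that image
the extension is constant, and this open set together with the chart covers G. -/
theorem continuous_extend_of_eq_const [T2Space G] [ProperSpace A] (hj : IsOpenEmbedding j)
    {Z : Type*} [TopologicalSpace Z] {F : A → Z} {z : Z}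
    (hF : Continuous F) (h : ∀ a, 1 ≤ ‖a‖ → F a = z) :
    Continuous (Function.extend j F (fun _ => z)) := by
  rw [continuous_iff_continuousAt]
  intro g
  by_cases hg : g ∈ range j
  · obtain ⟨a, rfl⟩ := hg
    rw [← hj.continuousAt_iff, Function.extend_comp hj.injective]
    exact hF.continuousAt
  · have hK : IsClosed (j '' Metric.closedBall 0 1) :=
      ((isCompact_closedBall 0 1).image hj.continuous).isClosed
    have hgK : g ∈ (j '' Metric.closedBall 0 1)ᶜ := fun h' => hg (image_subset_range _ _ h')
    refine (continuousAt_const (y := z)).congr ?_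
    filter_upwards [hK.isOpen_compl.mem_nhds hgK] with x hx
    by_cases hx' : x ∈ range j
    · obtain ⟨a, rfl⟩ := hx'
      rw [hj.injective.extend_apply, h]
      by_contra hlt
      exact hx ⟨a, by simpa using (not_le.1 hlt).le, rfl⟩
    · rw [Function.extend_apply' _ _ _ hx']

theorem continuous_radius [T2Space G] [ProperSpace A] (hj : IsOpenEmbedding j) :
    Continuous (radius j) :=
  continuous_extend_of_eq_const hj (by fun_prop) fun _ h => min_eq_right h

theorem continuous_cutVector [T2Space G] [ProperSpace A] (hj : IsOpenEmbedding j) :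
    Continuous (cutVector j) :=
  continuous_extend_of_eq_const hj (by fun_prop) fun a h => by
    rw [max_eq_left, zero_smul]
    exact (min_le_right _ _).trans (by linarith)

/-- Off the compact image of the unit ball the factor is 1, so scaling agrees there with the default
`id` used outside the chart. -/
theorem continuous_scale [T2Space G] [ProperSpace A] (hj : IsOpenEmbedding j)
    {Y : Type*} [TopologicalSpace Y] {k : Y → ℝ} {h : Y → G}
    (hk : Continuous k) (hh : Continuous h) (hk1 : ∀ y, 1 ≤ radius j (h y) → k y = 1) :
    Continuous fun y => scale j (k y) (h y) := by
  rw [continuous_iff_continuousAt]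
  intro y
  by_cases hg : h y ∈ range j
  · obtain ⟨a, ha⟩ := hg
    have hinv : ContinuousAt (Function.invFun j) (h y) := by
      rw [← ha, ← hj.continuousAt_iff, Function.invFun_comp hj.injective]
      exact continuousAt_id
    have h1 : ContinuousAt (fun y => j (k y • Function.invFun j (h y))) y :=
      hj.continuous.continuousAt.comp
        (hk.continuousAt.smul (ContinuousAt.comp hinv hh.continuousAt))
    refine h1.congr ?_
    have : h y ∈ range j := ⟨a, ha⟩
    filter_upwards [hh.continuousAt.preimage_mem_nhds (hj.isOpen_range.mem_nhds this)] with x hx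
    obtain ⟨b, hb⟩ := hx
    rw [← hb, scale_apply hj, Function.leftInverse_invFun hj.injective]
  · have hK : IsClosed (j '' Metric.closedBall 0 1) :=
      ((isCompact_closedBall 0 1).image hj.continuous).isClosed
    have hgK : h y ∈ (j '' Metric.closedBall 0 1)ᶜ := fun h' => hg (image_subset_range _ _ h')
    refine hh.continuousAt.congr ?_
    filter_upwards [hh.continuousAt.preimage_mem_nhds (hK.isOpen_compl.mem_nhds hgK)] with x hx
    by_cases hx' : h x ∈ range j
    · obtain ⟨a, ha⟩ := hx'
      have hlt : 1 < ‖a‖ := by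
        by_contra hlt
        exact hx ⟨a, by simpa using hlt, ha⟩
      rw [hk1 x (by rw [← ha, radius_apply hj]; exact le_min hlt.le le_rfl), ← ha,
        scale_apply hj, one_smul]
    · rw [scale, Function.extend_apply' _ _ _ hx', id]

theorem radius_nonneg (hj : IsOpenEmbedding j) (g : G) : 0 ≤ radius j g := by
  by_cases hg : g ∈ range j
  · obtain ⟨a, rfl⟩ := hg
    rw [radius_apply hj]; positivity
  · rw [radius, Function.extend_apply' _ _ _ hg]; exact zero_le_one

theorem exists_eq_of_radius_lt (hj : IsOpenEmbedding j) {g : G} (h : radius j g < 1) :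
    ∃ a, j a = g ∧ ‖a‖ = radius j g := by
  by_cases hg : g ∈ range j
  · obtain ⟨a, rfl⟩ := hg
    rw [radius_apply hj] at h ⊢
    refine ⟨a, rfl, (min_eq_left ?_).symm⟩
    by_contra h'
    rw [min_eq_right (not_le.1 h').le] at h
    exact lt_irrefl _ h
  · rw [radius, Function.extend_apply' _ _ _ hg] at h
    exact absurd h (lt_irrefl _)

theorem scale_one (hj : IsOpenEmbedding j) (g : G) : scale j 1 g = g := by
  by_cases hg : g ∈ range j
  · obtain ⟨a, rfl⟩ := hg
    rw [scale_apply hj, one_smul]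
  · rw [scale, Function.extend_apply' _ _ _ hg, id]

theorem scale_center (hj : IsOpenEmbedding j) (k : ℝ) : scale j k (j 0) = j 0 := by
  rw [scale_apply hj, smul_zero]

theorem eq_of_scale_eq_center (hj : IsOpenEmbedding j) {k : ℝ} {g : G} (h : scale j k g = j 0) :
    k = 0 ∨ g = j 0 := by
  by_cases hg : g ∈ range j
  · obtain ⟨a, rfl⟩ := hg
    rw [scale_apply hj] at h
    exact (smul_eq_zero.1 (hj.injective h)).imp_right (congrArg j)
  · rw [scale, Function.extend_apply' _ _ _ hg, id] at h
    exact Or.inr h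

theorem radius_center (hj : IsOpenEmbedding j) : radius j (j 0) = 0 := by
  rw [radius_apply hj]; simp

theorem cutVector_of_norm_le (hj : IsOpenEmbedding j) {a : A} (h : ‖a‖ ≤ 1 / 2) :
    cutVector j (j a) = a := by
  rw [cutVector_apply hj, min_eq_left (by linarith), max_eq_right zero_le_one, one_smul]

end Chart
end PuncturedProduct

/-! ### Weights and the nonvanishing estimate -/

/-- A chart of the group `G` centred at `1`, and a linear identification of `A × B` with the space
`E` under which a vector of the axis `B` corresponds to a unit vector. -/
structure PuncturedProduct.ChartData (G A B E : Type*) [TopologicalSpace G] [Group G]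
    [NormedAddCommGroup A] [NormedSpace ℝ A] [NormedAddCommGroup B] [InnerProductSpace ℝ B]
    [NormedAddCommGroup E] [NormedSpace ℝ E] where
  /-- the parametrization of a neighbourhood of `1` -/
  j : A → G
  isOpenEmbedding : IsOpenEmbedding j
  j_zero : j 0 = 1
  /-- the distinguished vector of `B` -/
  v : B
  v_ne_zero : v ≠ 0
  /-- the linear identification -/
  Φ : (A × B) ≃L[ℝ] E
  norm_base : ‖Φ (0, v)‖ = 1

namespace PuncturedProduct.ChartData

variable {G A B E : Type*} [TopologicalSpace G] [Group G]
    [NormedAddCommGroup A] [NormedSpace ℝ A] [NormedAddCommGroup B] [InnerProductSpace ℝ B]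
    [NormedAddCommGroup E] [NormedSpace ℝ E] (D : ChartData G A B E)

/-- The base point of the unit sphere of `E`. -/
noncomputable def base : Metric.sphere (0 : E) 1 :=
  ⟨D.Φ (0, D.v), by simpa using D.norm_base⟩

/-- A weight supported near the half line spanned by `-v` and positive on that half line. -/
noncomputable def ν (g : G) (b : B) : ℝ :=
  max 0 (min (1 / 2 - radius D.j g) (-inner ℝ b D.v))

/-- A weight vanishing exactly on the closed half line spanned by `-v`. -/
noncomputable def μ (g : G) (b : B) : ℝ :=
  radius D.j g + (‖b‖ * ‖D.v‖ + inner ℝ b D.v)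

/-- A weight which vanishes near `1` and equals `1` outside the unit ball of the chart. -/
noncomputable def lam (g : G) : ℝ := max 0 (2 * radius D.j g - 1)

/-- The vector whose normalization is the component of the retraction in the sphere. -/
noncomputable def vec (g : G) (b : B) : E :=
  D.Φ (D.ν g b • cutVector D.j g, D.ν g b • b + D.μ g b • D.v)

theorem nu_nonneg (g : G) (b : B) : 0 ≤ D.ν g b := le_max_left _ _

theorem lam_nonneg (g : G) : 0 ≤ D.lam g := le_max_left _ _

theorem inner_add_nonneg (b : B) : 0 ≤ ‖b‖ * ‖D.v‖ + inner ℝ b D.v := by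
  have := abs_le.1 (abs_real_inner_le_norm b D.v)
  linarith [this.1]

theorem mu_nonneg (g : G) (b : B) : 0 ≤ D.μ g b :=
  add_nonneg (radius_nonneg D.isOpenEmbedding g) (D.inner_add_nonneg b)

theorem radius_one : radius D.j 1 = 0 := by
  rw [← D.j_zero, radius_center D.isOpenEmbedding]

theorem radius_lt_of_nu_ne_zero {g : G} {b : B} (h : D.ν g b ≠ 0) : radius D.j g < 1 / 2 := by
  by_contra h'
  exact h (max_eq_left ((min_le_left _ _).trans (by linarith)))

/-- The common threshold 1/2 makes ν live only where the cutoff is inactive and `lam` is zero. -/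
theorem exists_of_nu_ne_zero {g : G} {b : B} (h : D.ν g b ≠ 0) :
    ∃ a, D.j a = g ∧ cutVector D.j g = a ∧ D.lam g = 0 := by
  have h1 := D.radius_lt_of_nu_ne_zero h
  obtain ⟨a, rfl, ha⟩ := exists_eq_of_radius_lt D.isOpenEmbedding (h1.trans (by norm_num))
  exact ⟨a, rfl, cutVector_of_norm_le D.isOpenEmbedding (by linarith),
    max_eq_left (by linarith)⟩

theorem nu_smul_cutVector (a : A) (b : B) :
    D.ν (D.j a) b • cutVector D.j (D.j a) = D.ν (D.j a) b • a := by
  by_cases h : D.ν (D.j a) b = 0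
  · simp [h]
  · obtain ⟨a', h1, h2, -⟩ := D.exists_of_nu_ne_zero h
    rw [h2, D.isOpenEmbedding.injective h1]

theorem nu_eq_zero_of_lam_ne_zero {g : G} (b : B) (h : D.lam g ≠ 0) : D.ν g b = 0 := by
  by_contra h'
  obtain ⟨-, -, -, h3⟩ := D.exists_of_nu_ne_zero h'
  exact h h3

theorem nu_eq_zero_of_one_le {g : G} (b : B) (h : 1 ≤ radius D.j g) : D.ν g b = 0 := by
  by_contra h'
  linarith [D.radius_lt_of_nu_ne_zero h']

theorem lam_eq_one {g : G} (h : 1 ≤ radius D.j g) : D.lam g = 1 := by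
  have : radius D.j g ≤ 1 := by
    by_contra h'
    by_cases hg : g ∈ range D.j
    · obtain ⟨a, rfl⟩ := hg
      rw [radius_apply D.isOpenEmbedding] at h'
      exact h' (min_le_right _ _)
    · rw [radius, Function.extend_apply' _ _ _ hg] at h'
      exact h' le_rfl
  rw [lam, le_antisymm this h]; norm_num

theorem nu_v (g : G) : D.ν g D.v = 0 :=
  max_eq_left ((min_le_right _ _).trans (neg_nonpos.2 real_inner_self_nonneg))

theorem mu_neg_smul {c : ℝ} (hc : 0 ≤ c) : D.μ 1 (-(c • D.v)) = 0 := by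
  rw [μ, radius_one, inner_neg_left, real_inner_smul_left, real_inner_self_eq_norm_sq, norm_neg,
    norm_smul, Real.norm_of_nonneg hc]
  ring

theorem nu_pos {c : ℝ} (hc : 0 < c) : 0 < D.ν 1 (-(c • D.v)) := by
  refine lt_max_of_lt_right (lt_min (by rw [D.radius_one]; norm_num) ?_)
  rw [inner_neg_left, neg_neg, real_inner_smul_left]
  exact mul_pos hc (real_inner_self_pos.2 D.v_ne_zero)

/-- Both summands of μ are nonnegative; the second vanishes exactly in the equality case of
Cauchy–Schwarz for -b and v. -/
theorem eq_of_mu_eq_zero {g : G} {b : B} (h : D.μ g b = 0) :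
    g = 1 ∧ ∃ c : ℝ, 0 ≤ c ∧ b = -(c • D.v) := by
  have h1 := radius_nonneg D.isOpenEmbedding g
  have h2 := D.inner_add_nonneg b
  rw [μ] at h
  have h3 : radius D.j g = 0 := by linarith
  constructor
  · obtain ⟨a, rfl, ha⟩ := exists_eq_of_radius_lt D.isOpenEmbedding (g := g) (by linarith)
    rw [h3, norm_eq_zero] at ha
    rw [ha, D.j_zero]
  · have h4 : inner ℝ (-b) D.v = ‖-b‖ * ‖D.v‖ := by
      rw [inner_neg_left, norm_neg]; linarith
    rw [inner_eq_norm_mul_iff_real, norm_neg] at h4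
    have hv : ‖D.v‖ ≠ 0 := norm_ne_zero_iff.2 D.v_ne_zero
    refine ⟨‖D.v‖⁻¹ * ‖b‖, by positivity, ?_⟩
    rw [mul_smul, ← h4, smul_smul, inv_mul_cancel₀ hv, one_smul, neg_neg]

/-- A nonnegative combination of the identity and of the retraction avoids the puncture. -/
theorem combination_ne_zero {g : G} {b : B} (h : (g, b) ≠ (1, 0)) {c₁ c₂ : ℝ} (h₁ : 0 ≤ c₁)
    (h₂ : 0 ≤ c₂) (h₁₂ : 0 < c₁ + c₂) (hA : c₁ + c₂ * D.ν g b = 0 ∨ g = 1) :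
    (c₁ + c₂ * D.ν g b) • b + (c₂ * D.μ g b) • D.v ≠ 0 := by
  intro h0
  have hν := D.nu_nonneg g b
  have hbne : g = 1 → b ≠ 0 := fun hg hb => h (by rw [hg, hb])
  rcases (D.mu_nonneg g b).eq_or_lt with hμ | hμ
  -- On the ray μ = 0 the puncture forces c > 0, hence ν > 0 and a positive coefficient of b.
  · obtain ⟨rfl, c, hc, rfl⟩ := D.eq_of_mu_eq_zero hμ.symm
    have hb := hbne rfl
    have hc' : 0 < c := hc.lt_of_ne (by rintro rfl; simp at hb)
    have hpos := D.nu_pos hc'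
    rw [← hμ, mul_zero, zero_smul, add_zero] at h0
    rcases smul_eq_zero.1 h0 with h0 | h0
    · rcases h₁.eq_or_lt with h1 | h1
      · nlinarith
      · nlinarith [mul_nonneg h₂ hν]
    · exact hb h0
  · rcases h₂.eq_or_lt with h2 | h2
    · rw [← h2] at h0 hA h₁₂
      simp only [zero_mul, add_zero, zero_smul] at h0 hA h₁₂
      rcases hA with hA | hA
      · exact h₁₂.ne' hA
      · exact (smul_eq_zero.1 h0).elim h₁₂.ne' (hbne hA)
    · have hB : 0 < c₂ * D.μ g b := mul_pos h2 hμ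
      by_cases hA0 : c₁ + c₂ * D.ν g b = 0
      · rw [hA0, zero_smul, zero_add] at h0
        exact (smul_eq_zero.1 h0).elim hB.ne' D.v_ne_zero
      · have hApos : 0 < c₁ + c₂ * D.ν g b :=
          lt_of_le_of_ne (by positivity) (Ne.symm hA0)
        obtain rfl := hA.resolve_left hA0
        -- Cancellation would put b on the ray along -v, where μ = 0.
        have hb : b = -(((c₁ + c₂ * D.ν 1 b)⁻¹ * (c₂ * D.μ 1 b)) • D.v) := by
          rw [mul_smul, ← smul_neg, ← eq_neg_of_add_eq_zero_left h0, smul_smul,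
            inv_mul_cancel₀ hA0, one_smul]
        have := D.mu_neg_smul (c := (c₁ + c₂ * D.ν 1 b)⁻¹ * (c₂ * D.μ 1 b)) (by positivity)
        rw [← hb] at this
        exact hμ.ne' this

theorem vec_ne_zero {g : G} {b : B} (h : (g, b) ≠ (1, 0)) : D.vec g b ≠ 0 := by
  intro h0
  rw [vec, ContinuousLinearEquiv.map_eq_zero_iff, Prod.mk_eq_zero] at h0
  refine D.combination_ne_zero h le_rfl zero_le_one (by norm_num) ?_ (by simpa using h0.2)
  by_cases hν : D.ν g b = 0
  · simp [hν]
  · obtain ⟨a, ha, ha', -⟩ := D.exists_of_nu_ne_zero hν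
    have := (smul_eq_zero.1 h0.1).resolve_left hν
    right
    rw [← ha, ← ha', this, D.j_zero]

theorem inv_norm_smul_vec_of_nu_eq_zero {g : G} {b : B} (h : (g, b) ≠ (1, 0))
    (hν : D.ν g b = 0) : ‖D.vec g b‖⁻¹ • D.vec g b = D.base := by
  have hv : D.vec g b = D.μ g b • D.Φ (0, D.v) := by
    rw [vec, hν, ← map_smul]; simp
  have hμ : D.μ g b ≠ 0 := by
    intro h0
    exact D.vec_ne_zero h (by rw [hv, h0, zero_smul])
  rw [hv, norm_smul, D.norm_base, mul_one, Real.norm_of_nonneg (D.mu_nonneg g b), smul_smul,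
    inv_mul_cancel₀ hμ, one_smul, base]

section Continuity

variable [T2Space G] [ProperSpace A]

theorem continuous_radius : Continuous (radius D.j) :=
  PuncturedProduct.continuous_radius D.isOpenEmbedding

theorem continuous_nu : Continuous fun p : G × B => D.ν p.1 p.2 := by
  have := D.continuous_radius
  unfold ν; fun_prop

theorem continuous_mu : Continuous fun p : G × B => D.μ p.1 p.2 := by
  have := D.continuous_radius
  unfold μ; fun_prop

theorem continuous_lam : Continuous D.lam := by
  have := D.continuous_radius
  unfold lam; fun_prop

theorem continuous_vec : Continuous fun p : G × B => D.vec p.1 p.2 := by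
  have := D.continuous_nu
  have := D.continuous_mu
  have := continuous_cutVector D.isOpenEmbedding
  unfold vec; fun_prop

end Continuity

/-! ### The two maps and their homotopies -/

/-- The inclusion of the wedge into the punctured product. -/
noncomputable def inclusion [ContinuousMul G] :
    C(WedgeAxes (1 : G) D.base, {p : G × B // p ≠ (1, 0)}) where
  toFun p := ⟨(p.1.1 * D.j (D.Φ.symm p.1.2).1, (D.Φ.symm p.1.2).2), by
    obtain ⟨⟨g, s⟩, h | h⟩ := p
    · obtain rfl : g = 1 := h
      intro h0
      simp only [one_mul, Prod.mk.injEq] at h0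
      have h1 : (D.Φ.symm s).1 = 0 := D.isOpenEmbedding.injective (h0.1.trans D.j_zero.symm)
      have h2 : D.Φ.symm (s : E) = 0 := Prod.ext h1 h0.2
      rw [ContinuousLinearEquiv.map_eq_zero_iff] at h2
      have := s.2
      rw [h2] at this
      simp at this
    · obtain rfl : s = D.base := h
      intro h0
      have h2 := (Prod.mk.inj h0).2
      simp only [base, ContinuousLinearEquiv.symm_apply_apply] at h2
      exact D.v_ne_zero h2⟩
  continuous_toFun := by
    have := D.isOpenEmbedding.continuous
    fun_prop

theorem scale_lam_eq_one {g : G} {b : B} (h : D.ν g b ≠ 0) : scale D.j (D.lam g) g = 1 := by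
  obtain ⟨a, rfl, -, h3⟩ := D.exists_of_nu_ne_zero h
  rw [h3, scale_apply D.isOpenEmbedding, zero_smul, D.j_zero]

theorem norm_inv_norm_smul {x : E} (hx : x ≠ 0) : ‖x‖⁻¹ • x ∈ Metric.sphere (0 : E) 1 := by
  rw [mem_sphere_zero_iff_norm, norm_smul, norm_inv, norm_norm,
    inv_mul_cancel₀ (norm_ne_zero_iff.2 hx)]

/-- The component of the retraction in the sphere. -/
noncomputable def sphereMap (p : {p : G × B // p ≠ (1, 0)}) : Metric.sphere (0 : E) 1 :=
  ⟨‖D.vec p.1.1 p.1.2‖⁻¹ • D.vec p.1.1 p.1.2, norm_inv_norm_smul (D.vec_ne_zero p.2)⟩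

theorem sphereMap_of_nu_eq_zero {p : {p : G × B // p ≠ (1, 0)}} (h : D.ν p.1.1 p.1.2 = 0) :
    D.sphereMap p = D.base :=
  Subtype.ext (D.inv_norm_smul_vec_of_nu_eq_zero p.2 h)

theorem continuous_sphereMap [T2Space G] [ProperSpace A] : Continuous D.sphereMap := by
  have h := D.continuous_vec.comp (continuous_subtype_val (p := fun p : G × B => p ≠ (1, 0)))
  exact ((h.norm.inv₀ fun p => norm_ne_zero_iff.2 (D.vec_ne_zero p.2)).smul h).subtype_mk _

/-- The retraction of the punctured product onto the wedge. -/
noncomputable def retraction [T2Space G] [ProperSpace A] :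
    C({p : G × B // p ≠ (1, 0)}, WedgeAxes (1 : G) D.base) where
  toFun p := ⟨(scale D.j (D.lam p.1.1) p.1.1, D.sphereMap p), by
    by_cases h : D.ν p.1.1 p.1.2 = 0
    · exact Or.inr (D.sphereMap_of_nu_eq_zero h)
    · exact Or.inl (D.scale_lam_eq_one h)⟩
  continuous_toFun := by
    have h1 := D.continuous_lam
    have h2 := D.continuous_sphereMap
    refine Continuous.subtype_mk (Continuous.prodMk ?_ h2) _
    exact continuous_scale D.isOpenEmbedding (by fun_prop) (by fun_prop) fun y hy => D.lam_eq_one hy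

theorem symm_sphereMap (p : {p : G × B // p ≠ (1, 0)}) :
    D.Φ.symm (D.sphereMap p) = ((‖D.vec p.1.1 p.1.2‖⁻¹ * D.ν p.1.1 p.1.2) • cutVector D.j p.1.1,
      (‖D.vec p.1.1 p.1.2‖⁻¹ * D.ν p.1.1 p.1.2) • p.1.2 +
        (‖D.vec p.1.1 p.1.2‖⁻¹ * D.μ p.1.1 p.1.2) • D.v) := by
  rw [sphereMap]
  simp only
  rw [map_smul]
  nth_rewrite 2 [vec]
  rw [ContinuousLinearEquiv.symm_apply_apply, Prod.smul_mk, smul_add, smul_smul, smul_smul,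
    smul_smul]

theorem symm_base : D.Φ.symm D.base = (0, D.v) := D.Φ.symm_apply_apply _

/-- The retraction followed by the inclusion is homotopic to the identity. -/
theorem inclusion_comp_retraction [T2Space G] [ProperSpace A] [ContinuousMul G] :
    (D.inclusion.comp D.retraction).Homotopic (ContinuousMap.id _) := by
  have hN : ∀ p : {p : G × B // p ≠ (1, 0)}, 0 < ‖D.vec p.1.1 p.1.2‖⁻¹ := fun p =>
    inv_pos.2 (norm_pos_iff.2 (D.vec_ne_zero p.2))
  let N : {p : G × B // p ≠ (1, 0)} → ℝ := fun p => ‖D.vec p.1.1 p.1.2‖⁻¹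
  have hNc : Continuous N :=
    (D.continuous_vec.comp continuous_subtype_val).norm.inv₀ fun p =>
      norm_ne_zero_iff.2 (D.vec_ne_zero p.2)
  -- At time 1 at most one of `lam` and N·ν is nonzero, so their sum describes the group coordinate
  -- of the composite in both cases.
  let k : unitInterval × {p : G × B // p ≠ (1, 0)} → ℝ := fun q =>
    1 - q.1.1 + q.1.1 * (D.lam q.2.1.1 + N q.2 * D.ν q.2.1.1 q.2.1.2)
  have hk : Continuous k := by
    have h1 := D.continuous_lam
    have h2 : Continuous fun p : {p : G × B // p ≠ (1, 0)} => D.ν p.1.1 p.1.2 :=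
      D.continuous_nu.comp continuous_subtype_val
    have h3 : Continuous fun q : unitInterval × {p : G × B // p ≠ (1, 0)} => q.1.1 := by fun_prop
    exact (continuous_const.sub h3).add (h3.mul
      ((h1.comp (by fun_prop : Continuous fun q : unitInterval × {p : G × B // p ≠ (1, 0)} =>
        q.2.1.1)).add ((hNc.mul h2).comp continuous_snd)))
  symm
  refine ⟨⟨⟨fun q => ⟨(scale D.j (k q) q.2.1.1,
    (1 - q.1.1) • q.2.1.2 + q.1.1 • (D.Φ.symm (D.sphereMap q.2)).2), ?_⟩, ?_⟩, ?_, ?_⟩⟩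
  · obtain ⟨t, p⟩ := q
    intro h0
    obtain ⟨h1, h2⟩ := Prod.mk.inj h0
    have ht0 := t.2.1
    have ht1 := t.2.2
    have hNp := hN p
    rw [symm_sphereMap] at h2
    refine D.combination_ne_zero p.2 (c₁ := 1 - t.1) (c₂ := t.1 * ‖D.vec p.1.1 p.1.2‖⁻¹)
      (by linarith) (by positivity) ?_ ?_ ?_
    · rcases ht0.eq_or_lt with h | h
      · rw [← h]; norm_num
      · have := mul_pos h hNp
        linarith
    · refine (eq_of_scale_eq_center D.isOpenEmbedding (h1.trans D.j_zero.symm)).imp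
        (fun h => ?_) (fun h => h.trans D.j_zero)
      have h3 := D.lam_nonneg p.1.1
      have h4 := D.nu_nonneg p.1.1 p.1.2
      have h5 := mul_nonneg ht0 h3
      have h6 := mul_nonneg ht0 (mul_nonneg hNp.le h4)
      simp only [k, N] at h
      nlinarith
    · refine Eq.trans ?_ h2
      module
  · have h1 : Continuous fun q : unitInterval × {p : G × B // p ≠ (1, 0)} =>
        (D.Φ.symm (D.sphereMap q.2)).2 :=
      (D.Φ.symm.continuous.comp (continuous_subtype_val.comp
        (D.continuous_sphereMap.comp continuous_snd))).snd
    refine Continuous.subtype_mk (Continuous.prodMk ?_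
      (Continuous.add (by fun_prop) (Continuous.smul (by fun_prop) h1))) _
    refine continuous_scale D.isOpenEmbedding hk (by fun_prop) fun q hq => ?_
    simp only [k]
    rw [D.lam_eq_one hq, D.nu_eq_zero_of_one_le _ hq]
    ring
  · intro p
    apply Subtype.ext
    simp [k, scale_one D.isOpenEmbedding]
  · intro p
    apply Subtype.ext
    simp only [k, inclusion, retraction, ContinuousMap.comp_apply, ContinuousMap.coe_mk,
      Set.Icc.coe_one, sub_self, zero_add, one_mul, zero_smul, one_smul]
    refine Prod.ext ?_ rfl
    rw [symm_sphereMap]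
    simp only
    by_cases hν : D.ν p.1.1 p.1.2 = 0
    · simp [hν, D.j_zero]
    · obtain ⟨a, h1, h2, h3⟩ := D.exists_of_nu_ne_zero hν
      rw [D.scale_lam_eq_one hν, h3, h2, one_mul, zero_add]
      conv_lhs => rw [← h1]
      rw [scale_apply D.isOpenEmbedding, h1]

/-- The inclusion followed by the retraction is homotopic to the identity. -/
theorem retraction_comp_inclusion [T2Space G] [ProperSpace A] [ContinuousMul G] :
    (D.retraction.comp D.inclusion).Homotopic (ContinuousMap.id _) := by
  have hj := D.isOpenEmbedding
  have hjc := hj.continuous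
  have hlam := D.continuous_lam
  have hsph : Continuous fun p => D.sphereMap (D.inclusion p) :=
    D.continuous_sphereMap.comp D.inclusion.continuous
  have hbase : ∀ g : G, ∀ h, D.sphereMap (D.inclusion ⟨(g, D.base), h⟩) = D.base := fun g h => by
    apply D.sphereMap_of_nu_eq_zero
    simp only [inclusion, ContinuousMap.coe_mk, symm_base]
    exact D.nu_v _
  have hscale1 : ∀ k, scale D.j k 1 = 1 := fun k => by
    rw [← D.j_zero, scale_center hj]
  -- An intermediate map: the composite with its group coordinate collapsed to 1 on the sphere axis.
  let M : C(WedgeAxes (1 : G) D.base, WedgeAxes (1 : G) D.base) :=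
    ⟨fun p => ⟨(scale D.j (D.lam p.1.1) p.1.1, D.sphereMap (D.inclusion p)), by
      obtain ⟨⟨g, s⟩, h | h⟩ := p
      · obtain rfl : g = 1 := h
        exact Or.inl (hscale1 _)
      · obtain rfl : s = D.base := h
        exact Or.inr (hbase _ _)⟩, by
      refine Continuous.subtype_mk (Continuous.prodMk ?_ hsph) _
      exact continuous_scale hj (by fun_prop) (by fun_prop) fun y hy => D.lam_eq_one hy⟩
  have h1 : M.Homotopic (D.retraction.comp D.inclusion) := by
    refine ⟨⟨⟨fun q => ⟨(scale D.j (D.lam q.2.1.1) q.2.1.1 *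
      D.j ((q.1.1 * D.lam (D.j (D.Φ.symm q.2.1.2).1)) • (D.Φ.symm q.2.1.2).1),
      D.sphereMap (D.inclusion q.2)), ?_⟩, ?_⟩, ?_, ?_⟩⟩
    · obtain ⟨t, ⟨⟨g, s⟩, h | h⟩⟩ := q
      · obtain rfl : g = 1 := h
        by_cases hν : D.lam (D.j (D.Φ.symm s).1) = 0
        · left
          simp only [hν, hscale1, mul_zero, zero_smul, D.j_zero, mul_one]
        -- Where `lam` is nonzero ν vanishes, so the sphere coordinate is the base point and the
        -- group coordinate is free to move.
        · right
          apply D.sphereMap_of_nu_eq_zero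
          simp only [inclusion, ContinuousMap.coe_mk, one_mul]
          exact D.nu_eq_zero_of_lam_ne_zero _ hν
      · obtain rfl : s = D.base := h
        exact Or.inr (hbase _ _)
    · refine Continuous.subtype_mk (Continuous.prodMk (Continuous.mul ?_ ?_)
        (hsph.comp continuous_snd)) _
      · exact continuous_scale hj (by fun_prop) (by fun_prop) fun y hy => D.lam_eq_one hy
      · fun_prop
    · intro p
      apply Subtype.ext
      simp [M, D.j_zero]
    · rintro ⟨⟨g, s⟩, h⟩
      apply Subtype.ext
      refine Prod.ext ?_ rfl
      simp only [inclusion, retraction, ContinuousMap.comp_apply, ContinuousMap.coe_mk,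
        Set.Icc.coe_one, one_mul]
      rcases h with h | h
      · obtain rfl : g = 1 := h
        rw [hscale1, one_mul, one_mul, scale_apply hj]
      · obtain rfl : s = D.base := h
        rw [symm_base]
        simp [D.j_zero]
  have h2 : (ContinuousMap.id _).Homotopic M := by
    -- A point of the sphere and its image are never antipodal, so the segment between them can be
    -- normalized.
    have hne : ∀ q : unitInterval × WedgeAxes (1 : G) D.base,
        (1 - q.1.1) • (q.2.1.2 : E) + q.1.1 • (D.sphereMap (D.inclusion q.2) : E) ≠ 0 := by
      rintro ⟨t, ⟨⟨g, s⟩, h | h⟩⟩ h0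
      · obtain rfl : g = 1 := h
        have ht0 := t.2.1
        have ht1 := t.2.2
        set p := D.inclusion ⟨(1, s), Or.inl rfl⟩ with hp
        have hp1 : p.1.1 = D.j (D.Φ.symm s).1 := by simp [hp, inclusion]
        have hp2 : p.1.2 = (D.Φ.symm s).2 := rfl
        have hNp : 0 < ‖D.vec p.1.1 p.1.2‖⁻¹ := inv_pos.2 (norm_pos_iff.2 (D.vec_ne_zero p.2))
        have h3 := congrArg D.Φ.symm h0
        simp only [map_add, map_smul, map_zero] at h3
        rw [symm_sphereMap] at h3
        have h4 := congrArg Prod.fst h3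
        have h5 := congrArg Prod.snd h3
        simp only [Prod.fst_add, Prod.snd_add, Prod.smul_fst, Prod.smul_snd, Prod.fst_zero,
          Prod.snd_zero] at h4 h5
        clear_value p
        refine D.combination_ne_zero (g := p.1.1) (b := p.1.2) p.2 (c₁ := 1 - t.1) (c₂ := t.1 * ‖D.vec p.1.1 p.1.2‖⁻¹)
          (by linarith) (by positivity) ?_ ?_ ?_
        · rcases ht0.eq_or_lt with h | h
          · rw [← h]; norm_num
          · have := mul_pos h hNp
            linarith
        · have h6 : (1 - t.1 + t.1 * ‖D.vec p.1.1 p.1.2‖⁻¹ * D.ν p.1.1 p.1.2) •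
              (D.Φ.symm s).1 = 0 := by
            have h7 : D.ν p.1.1 p.1.2 • cutVector D.j p.1.1 =
                D.ν p.1.1 p.1.2 • (D.Φ.symm s).1 := by
              rw [hp1]; exact D.nu_smul_cutVector _ _
            rw [mul_smul, h7] at h4
            refine Eq.trans ?_ h4
            module
          refine (smul_eq_zero.1 h6).imp_right fun h => ?_
          exact hp1.trans (by rw [h, D.j_zero])
        · rw [← hp2] at h5
          refine Eq.trans ?_ h5
          module
      · obtain rfl : s = D.base := h
        rw [hbase, ← add_smul, sub_add_cancel, one_smul] at h0
        have := D.base.2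
        rw [h0] at this
        simp at this
    have hcont : Continuous fun q : unitInterval × WedgeAxes (1 : G) D.base =>
        (1 - q.1.1) • (q.2.1.2 : E) + q.1.1 • (D.sphereMap (D.inclusion q.2) : E) := by
      exact Continuous.add (by fun_prop) (Continuous.smul (by fun_prop)
        (continuous_subtype_val.comp (hsph.comp continuous_snd)))
    refine ⟨⟨⟨fun q => ⟨(scale D.j (1 - q.1.1 + q.1.1 * D.lam q.2.1.1) q.2.1.1,
      ⟨_, norm_inv_norm_smul (hne q)⟩), ?_⟩, ?_⟩, ?_, ?_⟩⟩
    · obtain ⟨t, ⟨⟨g, s⟩, h | h⟩⟩ := q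
      · obtain rfl : g = 1 := h
        exact Or.inl (hscale1 _)
      · obtain rfl : s = D.base := h
        right
        apply Subtype.ext
        simp only
        rw [hbase, ← add_smul, sub_add_cancel, one_smul, norm_eq_of_mem_sphere, inv_one, one_smul]
    · refine Continuous.subtype_mk (Continuous.prodMk ?_ (Continuous.subtype_mk ?_ _)) _
      · refine continuous_scale hj (by fun_prop) (by fun_prop) fun y hy => ?_
        rw [D.lam_eq_one hy]; ring
      · exact (hcont.norm.inv₀ fun q => norm_ne_zero_iff.2 (hne q)).smul hcont
    · intro p
      apply Subtype.ext
      refine Prod.ext ?_ (Subtype.ext ?_)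
      · simp [scale_one hj]
      · simp
    · intro p
      apply Subtype.ext
      refine Prod.ext ?_ (Subtype.ext ?_)
      · simp [M]
      · simp [M]
  exact (h2.trans h1).symm

/-- The punctured product is homotopy equivalent to the union of the axes in the product of the
group with the sphere. -/
noncomputable def homotopyEquiv [T2Space G] [ProperSpace A] [ContinuousMul G] :
    {p : G × B // p ≠ (1, 0)} ≃ₕ WedgeAxes (1 : G) D.base where
  toFun := D.retraction
  invFun := D.inclusion
  left_inv := D.inclusion_comp_retraction
  right_inv := D.retraction_comp_inclusion

end PuncturedProduct.ChartData

/-! ### Splitting the configuration space and assembly -/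

/-- The configuration space of two points of `G × B` splits off a copy of `G × B`. -/
def ConfigurationSpace.homeomorphProd (G B : Type*) [TopologicalSpace G] [Group G]
    [IsTopologicalGroup G] [TopologicalSpace B] [AddCommGroup B] [IsTopologicalAddGroup B] :
    ConfigurationSpace (G × B) 2 ≃ₜ (G × B) × {p : G × B // p ≠ (1, 0)} where
  toFun x := (x.1 0, ⟨((x.1 0).1⁻¹ * (x.1 1).1, (x.1 1).2 - (x.1 0).2), fun h => by
    obtain ⟨h1, h2⟩ := Prod.mk.inj h
    have : x.1 0 = x.1 1 := Prod.ext (inv_mul_eq_one.1 h1) (sub_eq_zero.1 h2).symm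
    exact absurd (x.2 this) (by decide)⟩)
  invFun y := ⟨![y.1, (y.1.1 * y.2.1.1, y.1.2 + y.2.1.2)], by
    have hne : y.1 ≠ (y.1.1 * y.2.1.1, y.1.2 + y.2.1.2) := fun h => by
      refine y.2.2 (Prod.ext ?_ ?_)
      · simpa using congrArg Prod.fst h
      · simpa using congrArg Prod.snd h
    intro i k h
    fin_cases i <;> fin_cases k
    · rfl
    · exact absurd h hne
    · exact absurd h.symm hne
    · rfl⟩
  left_inv x := by
    apply Subtype.ext
    funext i
    fin_cases i <;> simp
  right_inv y := by
    refine Prod.ext rfl (Subtype.ext ?_)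
    simp
  continuous_toFun := by
    have h (i : Fin 2) : Continuous fun x : ConfigurationSpace (G × B) 2 => x.1 i :=
      (continuous_apply i).comp continuous_subtype_val
    exact (h 0).prodMk
      (((h 0).fst.inv.mul (h 1).fst).prodMk ((h 1).snd.sub (h 0).snd) |>.subtype_mk _)
  continuous_invFun := by
    refine Continuous.subtype_mk (continuous_pi fun i => ?_) _
    fin_cases i
    · exact continuous_fst
    · exact Continuous.prodMk (by fun_prop) (by fun_prop)

/-- Every point of a space modelled on a normed space is the centre of a chart onto the whole
model space. -/
theorem exists_isOpenEmbedding_of_chartedSpace {A G : Type*} [NormedAddCommGroup A]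
    [InnerProductSpace ℝ A] [TopologicalSpace G] [ChartedSpace A G] (g : G) :
    ∃ j : A → G, IsOpenEmbedding j ∧ j 0 = g := by
  let e := chartAt A g
  obtain ⟨r, hr, hball⟩ := Metric.isOpen_iff.1 e.open_target (e g) (mem_chart_target A g)
  let u := (OpenPartialHomeomorph.univBall (e g) r).trans e.symm
  have hu : u.source = univ := by
    rw [OpenPartialHomeomorph.trans_source, OpenPartialHomeomorph.univBall_source, univ_inter,
      eq_univ_iff_forall]
    intro x
    refine hball ?_
    rw [← OpenPartialHomeomorph.univBall_target (e g) hr]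
    exact OpenPartialHomeomorph.map_source _ (by simp)
  refine ⟨u, u.isOpenEmbedding hu, ?_⟩
  change e.symm (OpenPartialHomeomorph.univBall (e g) r 0) = g
  rw [OpenPartialHomeomorph.univBall_apply_zero]
  exact e.left_inv (mem_chart_source A g)

theorem mainTheorem3
    (m n : ℕ) (hm : 1 ≤ m) (hn : 1 ≤ n)
    (G : Type*) [TopologicalSpace G] [Group G]
    [ChartedSpace (EuclideanSpace ℝ (Fin m)) G] [LieGroup (𝓡 m) ∞ G]
    [CompactSpace G] [ConnectedSpace G]
    (g₀ : G) (s₀ : Metric.sphere (0 : EuclideanSpace ℝ (Fin (m + n))) 1) :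
    Nonempty (ConfigurationSpace (G × EuclideanSpace ℝ (Fin n)) 2 ≃ₕ G × Wedge g₀ s₀) := by
  have : IsTopologicalGroup G := topologicalGroup_of_lieGroup (𝓡 m) ∞
  -- A T1 topological group is Hausdorff, as the chart lemmas require.
  have : T1Space G := ChartedSpace.t1Space (EuclideanSpace ℝ (Fin m)) G
  obtain ⟨j, hj, hj1⟩ := exists_isOpenEmbedding_of_chartedSpace
    (A := EuclideanSpace ℝ (Fin m)) (1 : G)
  obtain ⟨k, rfl⟩ : ∃ k, n = k + 1 := ⟨n - 1, by omega⟩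
  obtain ⟨v, hv⟩ := exists_ne (0 : EuclideanSpace ℝ (Fin (k + 1)))
  let Φ₀ : (EuclideanSpace ℝ (Fin m) × EuclideanSpace ℝ (Fin (k + 1))) ≃L[ℝ]
      EuclideanSpace ℝ (Fin (m + (k + 1))) := ContinuousLinearEquiv.ofFinrankEq (by simp)
  have hs₀ : (s₀ : EuclideanSpace ℝ (Fin (m + (k + 1)))) ≠ 0 := ne_zero_of_mem_unit_sphere s₀
  have hv₀ : Φ₀ (0, v) ≠ 0 := by
    rw [Ne, ContinuousLinearEquiv.map_eq_zero_iff, Prod.mk_eq_zero]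
    exact fun h => hv h.2
  -- Choosing L this way makes the sphere's base point s₀; left translation by g₀ later handles that
  -- of G.
  obtain ⟨L, hL⟩ := SeparatingDual.exists_continuousLinearEquiv_apply_eq (R := ℝ) hv₀ hs₀
  let D : PuncturedProduct.ChartData G (EuclideanSpace ℝ (Fin m))
      (EuclideanSpace ℝ (Fin (k + 1))) (EuclideanSpace ℝ (Fin (m + (k + 1)))) :=
    { j := j
      isOpenEmbedding := hj
      j_zero := hj1
      v := v
      v_ne_zero := hv
      Φ := Φ₀.trans L
      norm_base := by
        rw [ContinuousLinearEquiv.trans_apply, hL]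
        exact norm_eq_of_mem_sphere s₀ }
  have hbase : D.base = s₀ := Subtype.ext hL
  obtain ⟨w⟩ := Wedge.nonempty_homeomorph_wedgeAxes g₀ s₀
  have e₁ := D.homotopyEquiv
  rw [hbase] at e₁
  have e₂ := (WedgeAxes.homeomorphOfEq s₀ (Homeomorph.mulLeft g₀) (mul_one g₀)).trans w.symm
  have : ContractibleSpace (EuclideanSpace ℝ (Fin (k + 1))) :=
    RealTopologicalVectorSpace.contractibleSpace
  obtain ⟨c⟩ := ContractibleSpace.hequiv_unit (EuclideanSpace ℝ (Fin (k + 1)))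
  have e₃ : G × EuclideanSpace ℝ (Fin (k + 1)) ≃ₕ G :=
    ((ContinuousMap.HomotopyEquiv.refl G).prodCongr c).trans
      (Homeomorph.prodPUnit G).toHomotopyEquiv
  exact ⟨(ConfigurationSpace.homeomorphProd G _).toHomotopyEquiv.trans
    (e₃.prodCongr (e₁.trans e₂.toHomotopyEquiv))⟩
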